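/- Let $k\ge 1$ be an integer and let $\alpha$ be a real number with $\alpha<-1/k$. Let $G(n,p)$ denote the random graph on the vertex set $\{1,\dots,n\}$ in which each of the $\binom n2$ possible edges is present independently with probability $p$, and let $X(n,p)$ be its clique complex, i.e. the simplicial complex whose faces are the nonempty vertex sets of complete subgraphs of $G(n,p)$. If $p=p(n)=n^{\alpha}$, then $\widetilde H_k(X(n,p);\mathbb Z)=0$ almost always, that is, $$\Pr\bigl[\widetilde H_k(X(n,n^{\alpha});\mathbb Z)=0\bigr]\longrightarrow 1\qquad\text{as } n\to\infty,$$ where $\widetilde H_k(\,\cdot\,;\mathbb Z)$ is reduced simplicial homology with integer coefficients. -/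

import Mathlib

/-- The clique complex `X(G)` of a simple graph `G`: its faces are the (nonempty, finite) vertex
sets of complete subgraphs of `G`. -/
def SimpleGraph.cliqueComplex {V : Type*} (G : SimpleGraph V) : AbstractSimplicialComplex V where
  faces := {s | s.Nonempty ∧ G.IsClique (s : Set V)}
  isRelLowerSet_faces := fun _ hs =>
    ⟨hs.1, fun _ hts ht => ⟨ht, hs.2.subset (Finset.coe_subset.mpr hts)⟩⟩
  singleton_mem := fun v => ⟨Finset.singleton_nonempty v, by simp⟩

namespace SimplicialHomology

variable {V : Type*} [LinearOrder V]

/-- The boundary operator of augmented simplicial chains with integer coefficients. A finite vertex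
set `{v₀ < v₁ < ⋯ < v_m}`, oriented by the order of the vertices, is sent to
`∑ i, (-1)^i {v₀, …, v_m} \ {v_i}`; here the position `i` of a vertex `v` is the number of smaller
vertices. The empty set is the generator in degree `-1`, so that on vertices this is the
augmentation map. -/
noncomputable def boundary : (Finset V →₀ ℤ) →ₗ[ℤ] (Finset V →₀ ℤ) :=
  Finsupp.lsum ℤ fun s : Finset V =>
    LinearMap.toSpanSingleton ℤ (Finset V →₀ ℤ)
      (∑ v ∈ s, Finsupp.single (s.erase v) ((-1 : ℤ) ^ (s.filter (· < v)).card))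

theorem boundary_single (s : Finset V) (a : ℤ) :
    boundary (Finsupp.single s a) =
      a • ∑ v ∈ s, Finsupp.single (s.erase v) ((-1 : ℤ) ^ (s.filter (· < v)).card) := by
  simp [boundary]

theorem boundary_boundary (c : Finset V →₀ ℤ) : boundary (boundary c) = 0 := by
  induction c using Finsupp.induction_linear with
  | zero => simp
  | add f g hf hg => simp [hf, hg]
  | single s a =>
    rw [boundary_single, map_smul, map_sum]
    simp only [boundary_single, Finset.smul_sum, Finsupp.smul_single, smul_eq_mul]
    rw [Finset.sum_sigma']
    refine Finset.sum_involution (fun x _ => ⟨x.2, x.1⟩) ?_ ?_ ?_ ?_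
    · have key : ∀ u v : V, u ∈ s → v ∈ s → u < v →
          (-1 : ℤ) ^ (s.filter (· < v)).card * (-1) ^ ((s.erase v).filter (· < u)).card =
          -((-1 : ℤ) ^ (s.filter (· < u)).card * (-1) ^ ((s.erase u).filter (· < v)).card) := by
        intro u v hu hv huv
        have h1 : (s.erase v).filter (· < u) = s.filter (· < u) := by
          ext w; simp only [Finset.mem_filter, Finset.mem_erase]
          exact ⟨fun h => ⟨h.1.2, h.2⟩, fun h => ⟨⟨(h.2.trans huv).ne, h.1⟩, h.2⟩⟩
        have h2 : (s.filter (· < v)).card = ((s.erase u).filter (· < v)).card + 1 := by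
          rw [Finset.filter_erase, Finset.card_erase_add_one]
          simp [hu, huv]
        rw [h1, h2]; ring
      rintro ⟨v, u⟩ hx
      simp only [Finset.mem_sigma, Finset.mem_erase] at hx
      obtain ⟨hv, huv, hu⟩ := hx
      dsimp only
      rw [Finset.erase_right_comm (a := u) (b := v), ← Finsupp.single_add]
      rcases lt_or_gt_of_ne huv with h | h
      · rw [key u v hu hv h]; simp
      · rw [key v u hv hu h]; simp
    · rintro ⟨v, u⟩ hx - h
      simp only [Finset.mem_sigma, Finset.mem_erase] at hx
      simp only [Sigma.mk.injEq, heq_eq_eq] at h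
      exact hx.2.1 h.1
    · rintro ⟨v, u⟩ hx
      simp only [Finset.mem_sigma, Finset.mem_erase] at hx ⊢
      exact ⟨hx.2.2, hx.2.1.symm, hx.1⟩
    · rintro ⟨v, u⟩ hx
      rfl

/-- The group `C_k(K; ℤ)` of simplicial `k`-chains of `K`: integer combinations of `k`-dimensional
faces, i.e. of faces with `k + 1` vertices. -/
noncomputable def chains (K : AbstractSimplicialComplex V) (k : ℕ) : Submodule ℤ (Finset V →₀ ℤ) :=
  Finsupp.supported ℤ ℤ {s | s ∈ K ∧ s.card = k + 1}

/-- The reduced `k`-cycles. For `k = 0` these are the `0`-chains of augmentation zero. -/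
noncomputable def cycles (K : AbstractSimplicialComplex V) (k : ℕ) : Submodule ℤ (Finset V →₀ ℤ) :=
  chains K k ⊓ LinearMap.ker boundary

/-- The `k`-boundaries: boundaries of `(k+1)`-chains. -/
noncomputable def boundaries (K : AbstractSimplicialComplex V) (k : ℕ) :
    Submodule ℤ (Finset V →₀ ℤ) :=
  (chains K (k + 1)).map boundary

theorem boundaries_le_cycles (K : AbstractSimplicialComplex V) (k : ℕ) :
    boundaries K k ≤ cycles K k := by
  rintro _ ⟨c, hc, rfl⟩
  refine ⟨?_, boundary_boundary c⟩
  have hc' : c ∈ chains K (k + 1) := hc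
  rw [chains, Finsupp.supported_eq_span_single] at hc'
  induction hc' using Submodule.span_induction with
  | mem x hx =>
    obtain ⟨s, ⟨hs, hcard⟩, rfl⟩ := hx
    rw [boundary_single, one_smul]
    refine Submodule.sum_mem _ fun v hv => Finsupp.single_mem_supported ℤ _ ?_
    have h1 : (s.erase v).card = k + 1 := by rw [Finset.card_erase_of_mem hv, hcard]; rfl
    exact ⟨(K.isRelLowerSet_faces hs).2 (Finset.erase_subset v s)
      (Finset.card_pos.mp (by omega)), h1⟩
  | zero => simp
  | add x y hx hy ihx ihy =>
    rw [map_add]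
    rw [← Finsupp.supported_eq_span_single] at hx hy
    exact Submodule.add_mem _ (ihx hx) (ihy hy)
  | smul a x hx ih =>
    rw [map_smul]
    rw [← Finsupp.supported_eq_span_single] at hx
    exact Submodule.smul_mem _ a (ih hx)

/-- The reduced simplicial homology group `H̃_k(K; ℤ)`, cycles modulo boundaries. -/
abbrev ReducedHomology (K : AbstractSimplicialComplex V) (k : ℕ) : Type _ :=
  cycles K k ⧸ (boundaries K k).submoduleOf (cycles K k)

end SimplicialHomology

/-!
The homology of the clique complex in dimension `k` can only be nonzero if the graph contains a
dense subgraph of bounded size, and for `p = n ^ α` with `α < -1 / k` the first-moment method rules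
out such subgraphs.

*Homology forces density.* A cycle can be pushed off a vertex `v` when its link at `v` bounds in
the clique complex of the neighbours of `v` (`acyclicOn_of_link_of_erase`). Induction on the number
of vertices shows that a clique complex on fewer than `2k` vertices has no reduced homology in
dimension `k - 1` (`acyclicOn_of_card_lt`): a vertex either is adjacent to all the others, so that
the complex is a cone, or has a link with at least two vertices fewer. Hence
nonzero `k`-th homology survives the removal of a vertex of degree less than `2k`, and a graph with
nonzero `k`-th homology contains a subgraph of minimum degree at least `2k`
(`acyclicOn_of_degenerate`). On `t` vertices this has at least `kt` edges, and the expected number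
of such subgraphs is of order `n ^ (t + α k t)`, which tends to zero for fixed `t`.

*The size is bounded.* Subgraphs of large minimum degree do occur on unboundedly many vertices, so
a second argument has to bound `t`. A `k`-cycle of least support among those that do not bound is
strongly connected (`exists_strongly_connected_cycle`). When its faces are added one by one across
common facets, each new vertex comes with `k` new edges. If the cycle has at least `N` vertices,
this yields exactly `N` vertices with at least `kN - k(k + 1)` edges (`exists_dense_subset`), and
the expected number of such subgraphs is of order at most `n ^ (N + α (kN - k(k + 1)))`. The
exponent is negative for `N` large, because `1 + α k < 0`. A union bound over the boundedly many
sizes concludes.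

Chains are handled with two operators for each vertex `v`, joining `v` to a face (`cone`) and
deleting `v` from a face (`link`). The sign rules `∂ C + C ∂ = 1`, `C L + L C = 1` and
`∂ L = -L ∂` replace exact sequences.
-/

/-! ### Cone and link operators on augmented chains -/

namespace SimplicialHomology

variable {V : Type*}

theorem map_mem_supported {f : (Finset V →₀ ℤ) →ₗ[ℤ] (Finset V →₀ ℤ)} {A B : Set (Finset V)}
    (h : ∀ s ∈ A, f (Finsupp.single s 1) ∈ Finsupp.supported ℤ ℤ B) {c : Finset V →₀ ℤ}
    (hc : c ∈ Finsupp.supported ℤ ℤ A) : f c ∈ Finsupp.supported ℤ ℤ B := by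
  have hle : (Finsupp.supported ℤ ℤ A).map f ≤ Finsupp.supported ℤ ℤ B := by
    rw [Finsupp.supported_eq_span_single, Submodule.map_span_le]
    rintro _ ⟨s, hs, rfl⟩
    exact h s hs
  exact hle (Submodule.mem_map_of_mem hc)

variable [LinearOrder V]

/-- The sign `(-1)^i` with which the vertex `v` is inserted into, or deleted from, the oriented
set `s`: the exponent `i` is the number of vertices of `s` below `v`. -/
def insertSign (s : Finset V) (v : V) : ℤ := (-1) ^ (s.filter (· < v)).card

theorem insertSign_mul_self (s : Finset V) (v : V) : insertSign s v * insertSign s v = 1 := by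
  rw [insertSign, ← mul_pow]; simp

theorem insertSign_insert_self (s : Finset V) (v : V) :
    insertSign (insert v s) v = insertSign s v := by
  simp [insertSign, Finset.filter_insert]

theorem insertSign_erase_self (s : Finset V) (v : V) :
    insertSign (s.erase v) v = insertSign s v := by
  simp [insertSign, Finset.filter_erase]

theorem insertSign_insert {s : Finset V} {u v : V} (hv : v ∉ s) :
    insertSign (insert v s) u = insertSign s u * (if v < u then -1 else 1) := by
  unfold insertSign
  rw [Finset.filter_insert]
  split_ifs with h
  · rw [Finset.card_insert_of_notMem (by simp [hv]), pow_succ]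
  · simp

theorem insertSign_erase {s : Finset V} {u v : V} (hv : v ∈ s) :
    insertSign (s.erase v) u = insertSign s u * (if v < u then -1 else 1) := by
  have h := insertSign_insert (u := u) (Finset.notMem_erase v s)
  rw [Finset.insert_erase hv] at h
  rw [h, mul_assoc]
  split_ifs <;> simp

/-- Inserting `u` and then deleting `v` gives the opposite sign to the reverse order. -/
theorem insertSign_mul_erase {s : Finset V} {u v : V} (hu : u ∉ s) (hv : v ∈ s) :
    insertSign s v * insertSign (s.erase v) u = -(insertSign s u * insertSign (insert u s) v) := by
  have huv : u ≠ v := fun h => hu (h ▸ hv)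
  rw [insertSign_erase hv, insertSign_insert hu]
  rcases lt_or_gt_of_ne huv with h | h <;> simp [h, h.not_gt, mul_comm]

theorem insertSign_erase_mul {s : Finset V} {u v : V} (hu : u ∈ s) (hv : v ∈ s) (huv : u ≠ v) :
    insertSign s v * insertSign (s.erase v) u = -(insertSign s u * insertSign (s.erase u) v) := by
  rw [insertSign_erase hv, insertSign_erase hu]
  rcases lt_or_gt_of_ne huv with h | h <;> simp [h, h.not_gt, mul_comm]

theorem boundary_single_one (s : Finset V) :
    boundary (Finsupp.single s 1) = ∑ v ∈ s, insertSign s v • Finsupp.single (s.erase v) 1 := by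
  simp [boundary_single, insertSign]

/-- The cone operator: `v` is joined to every generator that does not contain it, and the
generators that contain `v` are sent to zero. -/
noncomputable def cone (v : V) : (Finset V →₀ ℤ) →ₗ[ℤ] (Finset V →₀ ℤ) :=
  Finsupp.linearCombination ℤ fun s : Finset V =>
    if v ∈ s then 0 else insertSign s v • Finsupp.single (insert v s) 1

/-- The link operator: `v` is deleted from every generator that contains it, and the generators
that do not contain `v` are sent to zero. It takes a chain to its link at `v`. -/
noncomputable def link (v : V) : (Finset V →₀ ℤ) →ₗ[ℤ] (Finset V →₀ ℤ) :=
  Finsupp.linearCombination ℤ fun s : Finset V =>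
    if v ∈ s then insertSign s v • Finsupp.single (s.erase v) 1 else 0

theorem cone_single_of_mem {v : V} {s : Finset V} (h : v ∈ s) :
    cone v (Finsupp.single s 1) = 0 := by
  simp [cone, h]

theorem cone_single_of_notMem {v : V} {s : Finset V} (h : v ∉ s) :
    cone v (Finsupp.single s 1) = insertSign s v • Finsupp.single (insert v s) 1 := by
  simp [cone, h]

theorem link_single_of_mem {v : V} {s : Finset V} (h : v ∈ s) :
    link v (Finsupp.single s 1) = insertSign s v • Finsupp.single (s.erase v) 1 := by
  simp [link, h]

theorem link_single_of_notMem {v : V} {s : Finset V} (h : v ∉ s) :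
    link v (Finsupp.single s 1) = 0 := by
  simp [link, h]

/-- The cone operator is a contracting homotopy of the augmented chain complex. -/
theorem boundary_cone_add (v : V) (c : Finset V →₀ ℤ) :
    boundary (cone v c) + cone v (boundary c) = c := by
  have key : boundary ∘ₗ cone v + cone v ∘ₗ boundary = LinearMap.id := by
    refine Finsupp.lhom_ext' fun s => LinearMap.ext_ring ?_
    change boundary (cone v (Finsupp.single s 1)) + cone v (boundary (Finsupp.single s 1)) =
      Finsupp.single s 1
    rw [boundary_single_one, map_sum]
    simp only [map_smul]
    by_cases hv : v ∈ s
    · rw [cone_single_of_mem hv, map_zero, zero_add, Finset.sum_eq_single v]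
      · rw [cone_single_of_notMem (Finset.notMem_erase v s), insertSign_erase_self, smul_smul,
          insertSign_mul_self, one_smul, Finset.insert_erase hv]
      · intro u _ huv
        rw [cone_single_of_mem (Finset.mem_erase.mpr ⟨huv.symm, hv⟩), smul_zero]
      · exact fun h => absurd hv h
    · rw [cone_single_of_notMem hv, map_smul, boundary_single_one, Finset.sum_insert hv,
        smul_add, smul_smul, insertSign_insert_self, insertSign_mul_self, one_smul,
        Finset.erase_insert hv, add_assoc, Finset.smul_sum, ← Finset.sum_add_distrib,
        Finset.sum_eq_zero, add_zero]
      intro u hu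
      have huv : v ≠ u := fun h => hv (h ▸ hu)
      rw [cone_single_of_notMem (fun h => hv (Finset.mem_of_mem_erase h)), smul_smul, smul_smul,
        insertSign_mul_erase hv hu, Finset.erase_insert_of_ne huv, neg_smul, add_neg_cancel]
  exact LinearMap.congr_fun key c

theorem cone_link_add (v : V) (c : Finset V →₀ ℤ) :
    cone v (link v c) + link v (cone v c) = c := by
  have key : cone v ∘ₗ link v + link v ∘ₗ cone v = LinearMap.id := by
    refine Finsupp.lhom_ext' fun s => LinearMap.ext_ring ?_
    change cone v (link v (Finsupp.single s 1)) + link v (cone v (Finsupp.single s 1)) =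
      Finsupp.single s 1
    by_cases hv : v ∈ s
    · rw [cone_single_of_mem hv, link_single_of_mem hv, map_zero, add_zero, map_smul,
        cone_single_of_notMem (Finset.notMem_erase v s), insertSign_erase_self, smul_smul,
        insertSign_mul_self, one_smul, Finset.insert_erase hv]
    · rw [cone_single_of_notMem hv, link_single_of_notMem hv, map_zero, zero_add, map_smul,
        link_single_of_mem (Finset.mem_insert_self v s), insertSign_insert_self, smul_smul,
        insertSign_mul_self, one_smul, Finset.erase_insert hv]
  exact LinearMap.congr_fun key c

/-- In particular the link of a cycle is a cycle. -/
theorem boundary_link (v : V) (c : Finset V →₀ ℤ) :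
    boundary (link v c) = -link v (boundary c) := by
  have key : boundary ∘ₗ link v = -(link v ∘ₗ boundary) := by
    refine Finsupp.lhom_ext' fun s => LinearMap.ext_ring ?_
    change boundary (link v (Finsupp.single s 1)) = -link v (boundary (Finsupp.single s 1))
    rw [boundary_single_one, map_sum]
    simp only [map_smul]
    by_cases hv : v ∈ s
    · rw [link_single_of_mem hv, map_smul, boundary_single_one,
        ← Finset.sum_erase_add _ _ hv, link_single_of_notMem (Finset.notMem_erase v s), smul_zero,
        add_zero, Finset.smul_sum, ← Finset.sum_neg_distrib]
      refine Finset.sum_congr rfl fun u hu => ?_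
      obtain ⟨huv, hu⟩ := Finset.mem_erase.mp hu
      rw [link_single_of_mem (Finset.mem_erase.mpr ⟨huv.symm, hv⟩), smul_smul, smul_smul,
        insertSign_erase_mul hu hv huv, Finset.erase_right_comm, neg_smul]
    · rw [link_single_of_notMem hv, map_zero, Finset.sum_eq_zero, neg_zero]
      intro u _
      rw [link_single_of_notMem (fun h => hv (Finset.mem_of_mem_erase h)), smul_zero]
  exact LinearMap.congr_fun key c

end SimplicialHomology

/-! ### Acyclicity of clique complexes -/

namespace SimplicialHomology

variable {V : Type*}

/-- The integer chains spanned by the cliques of `G` that lie in `S` and have exactly `j` vertices.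
The grading is by the number of vertices, one more than the dimension, so that `j = 0` is the
augmentation degree spanned by the empty clique. -/
noncomputable def cliqueChains (G : SimpleGraph V) (S : Finset V) (j : ℕ) :
    Submodule ℤ (Finset V →₀ ℤ) :=
  Finsupp.supported ℤ ℤ {s | s ⊆ S ∧ G.IsClique (s : Set V) ∧ s.card = j}

variable {G : SimpleGraph V} {S T : Finset V} {j : ℕ} {v : V}

theorem single_mem_cliqueChains {s : Finset V} (hs : s ⊆ S) (hG : G.IsClique (s : Set V))
    (hj : s.card = j) : Finsupp.single s 1 ∈ cliqueChains G S j :=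
  Finsupp.single_mem_supported ℤ _ ⟨hs, hG, hj⟩

theorem cliqueChains_mono (h : S ⊆ T) : cliqueChains G S j ≤ cliqueChains G T j :=
  Finsupp.supported_mono fun _ hs => ⟨hs.1.trans h, hs.2⟩

theorem eq_zero_of_card_lt {c : Finset V →₀ ℤ} (h : S.card < j) (hc : c ∈ cliqueChains G S j) :
    c = 0 := by
  have he : {s : Finset V | s ⊆ S ∧ G.IsClique (s : Set V) ∧ s.card = j} = ∅ := by
    refine Set.eq_empty_of_forall_notMem fun s hs => ?_
    have := Finset.card_le_card hs.1
    have := hs.2.2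
    omega
  rw [cliqueChains, he, Finsupp.supported_empty] at hc
  exact hc

variable [LinearOrder V]

/-- Every cycle on cliques with `j` vertices in `S` is a boundary, i.e. the reduced homology of the
clique complex of `G` induced on `S` vanishes in dimension `j - 1`. -/
def AcyclicOn (G : SimpleGraph V) (S : Finset V) (j : ℕ) : Prop :=
  ∀ z ∈ cliqueChains G S j, boundary z = 0 → ∃ c ∈ cliqueChains G S (j + 1), boundary c = z

theorem cone_mem_cliqueChains {L : Finset V} (hL : ∀ u ∈ L, u ≠ v → G.Adj v u)
    {c : Finset V →₀ ℤ} (hc : c ∈ cliqueChains G L j) :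
    cone v c ∈ cliqueChains G (insert v L) (j + 1) := by
  refine map_mem_supported ?_ hc
  rintro s ⟨hs, hG, hj⟩
  by_cases hv : v ∈ s
  · rw [cone_single_of_mem hv]; exact Submodule.zero_mem _
  · rw [cone_single_of_notMem hv]
    refine Submodule.smul_mem _ _ (single_mem_cliqueChains (Finset.insert_subset_insert v hs) ?_ ?_)
    · rw [Finset.coe_insert, SimpleGraph.isClique_insert]
      exact ⟨hG, fun u hu huv => hL u (hs hu) huv.symm⟩
    · rw [Finset.card_insert_of_notMem hv, hj]

open Classical in
theorem link_mem_cliqueChains {c : Finset V →₀ ℤ} (hc : c ∈ cliqueChains G S (j + 1)) :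
    link v c ∈ cliqueChains G (S.filter (G.Adj v)) j := by
  refine map_mem_supported ?_ hc
  rintro s ⟨hs, hG, hj⟩
  by_cases hv : v ∈ s
  · rw [link_single_of_mem hv]
    refine Submodule.smul_mem _ _ (single_mem_cliqueChains ?_ ?_ ?_)
    · intro u hu
      obtain ⟨huv, hu⟩ := Finset.mem_erase.mp hu
      exact Finset.mem_filter.mpr
        ⟨hs hu, hG (Finset.mem_coe.mpr hv) (Finset.mem_coe.mpr hu) huv.symm⟩
    · exact hG.subset (by simp)
    · rw [Finset.card_erase_of_mem hv, hj]; rfl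
  · rw [link_single_of_notMem hv]; exact Submodule.zero_mem _

/-- `link v ∘ cone v` is the projection onto the chains that avoid `v`. -/
theorem link_cone_mem_cliqueChains {c : Finset V →₀ ℤ} (hc : c ∈ cliqueChains G S j) :
    link v (cone v c) ∈ cliqueChains G (S.erase v) j := by
  refine map_mem_supported (f := link v ∘ₗ cone v) ?_ hc
  rintro s ⟨hs, hG, hj⟩
  rw [LinearMap.comp_apply]
  by_cases hv : v ∈ s
  · rw [cone_single_of_mem hv, map_zero]; exact Submodule.zero_mem _
  · rw [cone_single_of_notMem hv, map_smul, link_single_of_mem (Finset.mem_insert_self v s),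
      insertSign_insert_self, smul_smul, insertSign_mul_self, one_smul, Finset.erase_insert hv]
    exact single_mem_cliqueChains (Finset.subset_erase.mpr ⟨hs, hv⟩) hG hj

theorem acyclicOn_of_forall_adj (hv : v ∈ S) (h : ∀ u ∈ S, u ≠ v → G.Adj v u) :
    AcyclicOn G S j := by
  intro z hz hz0
  refine ⟨cone v z, ?_, ?_⟩
  · simpa [Finset.insert_eq_of_mem hv] using cone_mem_cliqueChains h hz
  · simpa [hz0] using boundary_cone_add v z

open Classical in
/-- A cycle can be pushed off the vertex `v` as soon as its link at `v` bounds among the neighbours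
of `v`. This replaces the Mayer-Vietoris sequence of the star of `v` and the complement of `v`. -/
theorem acyclicOn_of_link_of_erase (hv : v ∈ S) (hlink : AcyclicOn G (S.filter (G.Adj v)) j)
    (herase : AcyclicOn G (S.erase v) (j + 1)) : AcyclicOn G S (j + 1) := by
  intro z hz hz0
  obtain ⟨c, hc, hcz⟩ := hlink (link v z) (link_mem_cliqueChains hz)
    (by rw [boundary_link, hz0, map_zero, neg_zero])
  -- The homotopy identities give `z + ∂ (cone v c) = link v (cone v z) + c`, which avoids `v`.
  have hpush : z + boundary (cone v c) = link v (cone v z) + c := by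
    have h1 := boundary_cone_add v c
    have h2 := cone_link_add v z
    rw [hcz] at h1
    linear_combination (norm := module) h1 - h2
  have hsub : S.filter (G.Adj v) ⊆ S.erase v := fun u hu => by
    obtain ⟨hu, huv⟩ := Finset.mem_filter.mp hu
    exact Finset.mem_erase.mpr ⟨huv.ne', hu⟩
  obtain ⟨d, hd, hdz⟩ := herase (z + boundary (cone v c))
    (hpush ▸ Submodule.add_mem _ (link_cone_mem_cliqueChains hz) (cliqueChains_mono hsub hc))
    (by rw [map_add, hz0, boundary_boundary, add_zero])
  have hcone : cone v c ∈ cliqueChains G S (j + 1 + 1) := by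
    refine cliqueChains_mono ?_
      (cone_mem_cliqueChains (fun u hu _ => (Finset.mem_filter.mp hu).2) hc)
    exact Finset.insert_subset hv (Finset.filter_subset _ _)
  exact ⟨d - cone v c, Submodule.sub_mem _ (cliqueChains_mono (Finset.erase_subset v S) hd) hcone,
    by rw [map_sub, hdz, add_sub_cancel_right]⟩

/-- A clique complex on fewer than `2j` vertices has no reduced homology in dimension `j - 1`. The
bound is sharp: the boundary of the `j`-dimensional cross-polytope has `2j` vertices. -/
theorem acyclicOn_of_card_lt (h : S.card < 2 * j) : AcyclicOn G S j := by
  classical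
  induction hn : S.card using Nat.strong_induction_on generalizing S j with
  | _ n ih =>
    subst hn
    obtain _ | j := j
    · omega
    obtain rfl | ⟨v, hv⟩ := S.eq_empty_or_nonempty
    · intro z hz _
      exact ⟨0, Submodule.zero_mem _, by rw [eq_zero_of_card_lt (by simp) hz, map_zero]⟩
    by_cases hcone : ∀ u ∈ S, u ≠ v → G.Adj v u
    · exact acyclicOn_of_forall_adj hv hcone
    push Not at hcone
    obtain ⟨u, hu, huv, hadj⟩ := hcone
    have herase := Finset.card_erase_lt_of_mem hv
    have hlink : (S.filter (G.Adj v)).card + 2 ≤ S.card := by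
      have hsub : S.filter (G.Adj v) ⊆ (S.erase v).erase u := fun w hw => by
        obtain ⟨hw, hvw⟩ := Finset.mem_filter.mp hw
        exact Finset.mem_erase.mpr ⟨fun e => hadj (e ▸ hvw), Finset.mem_erase.mpr ⟨hvw.ne', hw⟩⟩
      have h1 := Finset.card_le_card hsub
      have h2 := Finset.card_erase_add_one (Finset.mem_erase.mpr ⟨huv, hu⟩ : u ∈ S.erase v)
      have h3 := Finset.card_erase_add_one hv
      omega
    exact acyclicOn_of_link_of_erase hv (ih _ (by omega) (by omega) rfl)
      (ih _ herase (by omega) rfl)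

open Classical in
/-- If the graph on `S` can be dismantled by removing vertices of degree less than `2j`, then its
clique complex has no reduced homology in dimension `j`. -/
theorem acyclicOn_of_degenerate
    (h : ∀ T ⊆ S, T.Nonempty → ∃ v ∈ T, (T.filter (G.Adj v)).card < 2 * j) :
    AcyclicOn G S (j + 1) := by
  induction hn : S.card using Nat.strong_induction_on generalizing S with
  | _ n ih =>
    subst hn
    obtain rfl | hS := S.eq_empty_or_nonempty
    · intro z hz _
      exact ⟨0, Submodule.zero_mem _, by rw [eq_zero_of_card_lt (by simp) hz, map_zero]⟩
    obtain ⟨v, hv, hdeg⟩ := h S subset_rfl hS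
    exact acyclicOn_of_link_of_erase hv (acyclicOn_of_card_lt hdeg)
      (ih _ (Finset.card_erase_lt_of_mem hv)
        (fun T hT => h T (hT.trans (Finset.erase_subset v S))) rfl)

theorem subsingleton_reducedHomology [Fintype V] {k : ℕ}
    (h : AcyclicOn G Finset.univ (k + 1)) :
    Subsingleton (ReducedHomology G.cliqueComplex k) := by
  have hchains : ∀ m, chains G.cliqueComplex m = cliqueChains G Finset.univ (m + 1) := by
    intro m
    unfold chains cliqueChains
    congr 1
    ext s
    refine ⟨fun hs => ⟨s.subset_univ, hs.1.2, hs.2⟩, fun hs => ⟨⟨?_, hs.2.1⟩, hs.2.2⟩⟩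
    exact Finset.card_pos.mp (by have := hs.2.2; omega)
  rw [Submodule.Quotient.subsingleton_iff, Submodule.submoduleOf_eq_top]
  rintro z ⟨hz, hz0⟩
  obtain ⟨c, hc, hcz⟩ := h z (hchains k ▸ hz) hz0
  exact ⟨c, (hchains (k + 1)).symm ▸ hc, hcz⟩

end SimplicialHomology

/-! ### Edges inside a vertex set -/

/-- `G` has at least `m` edges with both ends in `T`. -/
def SimpleGraph.HasEdgesIn {V : Type*} (G : SimpleGraph V) (T : Finset V) (m : ℕ) : Prop :=
  ∃ F : Finset (Sym2 V), (F : Set (Sym2 V)) ⊆ G.edgeSet ∧ (∀ e ∈ F, ∀ x ∈ e, x ∈ T) ∧ F.card = m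

namespace SimpleGraph.HasEdgesIn

variable {V : Type*} {G : SimpleGraph V} {T : Finset V} {m : ℕ}

theorem mono {m' : ℕ} (h : G.HasEdgesIn T m) (hm : m' ≤ m) : G.HasEdgesIn T m' := by
  obtain ⟨F, hG, hT, rfl⟩ := h
  obtain ⟨F', hF', hcard⟩ := Finset.exists_subset_card_eq hm
  exact ⟨F', (Finset.coe_subset.mpr hF').trans hG, fun e he => hT e (hF' he), hcard⟩

theorem zero : G.HasEdgesIn T 0 := ⟨∅, by simp, by simp, rfl⟩

theorem insert_vertex [DecidableEq V] {w : V} {A : Finset V} (h : G.HasEdgesIn T m) (hw : w ∉ T)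
    (hA : A ⊆ T) (hadj : ∀ u ∈ A, G.Adj w u) : G.HasEdgesIn (insert w T) (m + A.card) := by
  obtain ⟨F, hG, hT, rfl⟩ := h
  have hinj : Function.Injective (fun u : V => s(w, u)) := fun a b hab => Sym2.congr_right.mp hab
  have hdisj : Disjoint F (A.map ⟨_, hinj⟩) := by
    rw [Finset.disjoint_left]
    intro e he he'
    obtain ⟨u, _, rfl⟩ := Finset.mem_map.mp he'
    exact hw (hT _ he w (Sym2.mem_mk_left w u))
  refine ⟨F ∪ A.map ⟨_, hinj⟩, ?_, ?_, ?_⟩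
  · rw [Finset.coe_union, Set.union_subset_iff]
    refine ⟨hG, fun e he => ?_⟩
    obtain ⟨u, hu, rfl⟩ := Finset.mem_map.mp (Finset.mem_coe.mp he)
    exact hadj u hu
  · intro e he x hx
    rcases Finset.mem_union.mp he with he | he
    · exact Finset.mem_insert_of_mem (hT e he x hx)
    · obtain ⟨u, hu, rfl⟩ := Finset.mem_map.mp he
      rcases Sym2.mem_iff.mp hx with rfl | rfl
      · exact Finset.mem_insert_self _ _
      · exact Finset.mem_insert_of_mem (hA hu)
  · rw [Finset.card_union_of_disjoint hdisj, Finset.card_map]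

open Classical in
theorem of_le_degree [Fintype V] {d : ℕ} (h : ∀ v ∈ T, 2 * d ≤ (T.filter (G.Adj v)).card) :
    G.HasEdgesIn T (d * T.card) := by
  let H : SimpleGraph V :=
    { Adj := fun u v => G.Adj u v ∧ u ∈ T ∧ v ∈ T
      symm := ⟨fun u v huv => ⟨huv.1.symm, huv.2.2, huv.2.1⟩⟩
      loopless := ⟨fun u hu => G.irrefl hu.1⟩ }
  have hdeg : ∀ v ∈ T, 2 * d ≤ H.degree v := fun v hv => by
    refine (h v hv).trans (Finset.card_le_card fun u hu => ?_)
    obtain ⟨hu, huv⟩ := Finset.mem_filter.mp hu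
    exact (H.mem_neighborFinset v u).mpr ⟨huv, hv, hu⟩
  have hsum : T.card * (2 * d) ≤ 2 * H.edgeFinset.card := by
    rw [← H.sum_degrees_eq_twice_card_edges, ← smul_eq_mul]
    exact (Finset.card_nsmul_le_sum T _ _ hdeg).trans
      (Finset.sum_le_sum_of_subset (Finset.subset_univ T))
  refine mono (m := H.edgeFinset.card) ⟨H.edgeFinset, ?_, ?_, rfl⟩ (by nlinarith)
  · rw [coe_edgeFinset]
    exact edgeSet_mono fun u v huv => huv.1
  · intro e he x hx
    rw [mem_edgeFinset] at he
    induction e with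
    | _ a b =>
      rcases Sym2.mem_iff.mp hx with rfl | rfl
      · exact he.2.1
      · exact he.2.2

end SimpleGraph.HasEdgesIn

/-! ### Strongly connected cycles and dense subgraphs -/

namespace SimplicialHomology

variable {V : Type*} [LinearOrder V] {G : SimpleGraph V} {j k : ℕ}

theorem boundary_mem_supported_erase (c : Finset V →₀ ℤ) :
    boundary c ∈ Finsupp.supported ℤ ℤ
      {t : Finset V | ∃ s ∈ c.support, ∃ v ∈ s, t = s.erase v} := by
  refine map_mem_supported (A := c.support) (fun s hs => ?_)
    ((Finsupp.mem_supported ℤ c).mpr subset_rfl)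
  rw [boundary_single_one]
  exact Submodule.sum_mem _ fun v hv => Submodule.smul_mem _ _
    (Finsupp.single_mem_supported ℤ _ ⟨s, hs, v, hv, rfl⟩)

/-- If no face in `P` shares a facet with a face of the cycle `z` outside `P`, then the part of `z`
in `P` is itself a cycle: its boundary and that of the other part have disjoint supports. -/
theorem boundary_filter_eq_zero {z : Finset V →₀ ℤ} (hz : boundary z = 0) (P : Finset V → Prop)
    [DecidablePred P] (hP : ∀ s ∈ z.support, P s → ∀ t ∈ z.support, ¬ P t →
      ∀ v ∈ s, ∀ w ∈ t, s.erase v ≠ t.erase w) :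
    boundary (z.filter P) = 0 := by
  have hsum : boundary (z.filter P) = -boundary (z.filter fun s => ¬ P s) := by
    rw [eq_neg_iff_add_eq_zero, ← map_add, Finsupp.filter_add_filter_not, hz]
  have h1 := boundary_mem_supported_erase (z.filter P)
  have h2 : boundary (z.filter P) ∈ _ :=
    hsum ▸ Submodule.neg_mem _ (boundary_mem_supported_erase (z.filter fun s => ¬ P s))
  refine Submodule.disjoint_def.mp (Finsupp.disjoint_supported_supported ?_) _ h1 h2
  rw [Set.disjoint_left]
  rintro _ ⟨s, hs, v, hv, rfl⟩ ⟨t, ht, w, hw, hst⟩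
  simp only [Finsupp.support_filter, Finset.mem_filter] at hs ht
  exact hP s hs.1 hs.2 t ht.1 ht.2 v hv w hw hst

/-- A cycle of least support among those that do not bound has strongly connected support: it
cannot be split into two nonempty parts without a common facet. -/
theorem exists_strongly_connected_cycle {S : Finset V} (h : ¬ AcyclicOn G S j) :
    ∃ z ∈ cliqueChains G S j, boundary z = 0 ∧ (¬ ∃ c ∈ cliqueChains G S (j + 1), boundary c = z) ∧
      ∀ P ⊂ z.support, P.Nonempty → ∃ s ∈ P, ∃ t ∈ z.support, t ∉ P ∧
        ∃ v ∈ s, ∃ w ∈ t, s.erase v = t.erase w := by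
  classical
  let p : ℕ → Prop := fun n => ∃ z ∈ cliqueChains G S j, boundary z = 0 ∧
    (¬ ∃ c ∈ cliqueChains G S (j + 1), boundary c = z) ∧ z.support.card = n
  have hp : ∃ n, p n := by
    simp only [AcyclicOn, not_forall] at h
    obtain ⟨z, hz, hz0, hc⟩ := h
    exact ⟨_, z, hz, hz0, hc, rfl⟩
  obtain ⟨z, hz, hz0, hc, hcard⟩ := Nat.find_spec hp
  have hbound : ∀ y ∈ cliqueChains G S j, boundary y = 0 → y.support.card < z.support.card →
      ∃ c ∈ cliqueChains G S (j + 1), boundary c = y := by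
    intro y hy hy0 hlt
    by_contra hne
    exact Nat.find_min hp (hcard ▸ hlt) ⟨y, hy, hy0, hne, rfl⟩
  have hmem : ∀ (Q : Finset V → Prop) [DecidablePred Q], z.filter Q ∈ cliqueChains G S j := fun Q _ => by
    rw [cliqueChains, Finsupp.mem_supported] at hz ⊢
    rw [Finsupp.support_filter]
    exact (Finset.coe_subset.mpr (Finset.filter_subset _ _)).trans hz
  refine ⟨z, hz, hz0, hc, fun P hP hPne => ?_⟩
  by_contra hcon
  push Not at hcon
  have hb1 : boundary (z.filter (· ∈ P)) = 0 :=
    boundary_filter_eq_zero hz0 _ fun s _ hs t ht htP v hv w hw => hcon s hs t ht htP v hv w hw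
  have hsplit : z.filter (· ∈ P) + z.filter (· ∉ P) = z := Finsupp.filter_add_filter_not z _
  have hb2 : boundary (z.filter (· ∉ P)) = 0 := by
    have := congrArg boundary hsplit
    rwa [map_add, hb1, zero_add, hz0] at this
  obtain ⟨x, hxz, hxP⟩ := Finset.exists_of_ssubset hP
  obtain ⟨y, hy⟩ := hPne
  obtain ⟨c, hcm, hcz⟩ := hbound _ (hmem (· ∈ P)) hb1 (by
    rw [Finsupp.support_filter]
    exact Finset.card_lt_card (Finset.filter_ssubset.mpr ⟨x, hxz, hxP⟩))
  obtain ⟨d, hdm, hdz⟩ := hbound _ (hmem (· ∉ P)) hb2 (by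
    rw [Finsupp.support_filter]
    exact Finset.card_lt_card (Finset.filter_ssubset.mpr ⟨y, hP.1 hy, not_not.mpr hy⟩))
  exact hc ⟨c + d, Submodule.add_mem _ hcm hdm, by rw [map_add, hcz, hdz, hsplit]⟩

/-- Nonvanishing homology forces a dense subgraph of bounded size. The vertices of a strongly
connected cycle can be collected face by face, every new vertex bringing `k` new edges. If this
stops before reaching `N` vertices, the cycle lives on a bounded vertex set, which contains a
subgraph of minimum degree at least `2k`. -/
theorem exists_dense_subset [Fintype V] {N : ℕ} (hN : k + 1 ≤ N)
    (h : ¬ AcyclicOn G Finset.univ (k + 1)) :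
    ∃ T : Finset V, T.Nonempty ∧ T.card ≤ N ∧ (G.HasEdgesIn T (k * T.card) ∨
      T.card = N ∧ G.HasEdgesIn T (k * N - k * (k + 1))) := by
  classical
  obtain ⟨z, hz, hz0, hc, hconn⟩ := exists_strongly_connected_cycle h
  have hface : ∀ s ∈ z.support, G.IsClique (s : Set V) ∧ s.card = k + 1 :=
    fun s hs => ((Finsupp.mem_supported ℤ z).mp hz hs).2
  have hzne : z.support.Nonempty := by
    rw [Finsupp.support_nonempty_iff]
    rintro rfl
    exact hc ⟨0, Submodule.zero_mem _, map_zero _⟩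
  -- `A` collects the sets of faces whose vertices span enough edges; a largest one is taken.
  let A : Finset (Finset (Finset V)) := z.support.powerset.filter fun P =>
    P.Nonempty ∧ (P.sup id).card ≤ N ∧ G.HasEdgesIn (P.sup id) (k * (P.sup id).card - k * (k + 1))
  have hA : A.Nonempty := by
    obtain ⟨s, hs⟩ := hzne
    refine ⟨{s}, Finset.mem_filter.mpr ⟨by simpa using hs, Finset.singleton_nonempty s, ?_, ?_⟩⟩
    · simpa [(hface s hs).2] using hN
    · simpa [(hface s hs).2] using SimpleGraph.HasEdgesIn.zero
  obtain ⟨P, hPA, hmax⟩ := A.exists_max_image Finset.card hA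
  obtain ⟨hPz, hPne, hPN, hPe⟩ := Finset.mem_filter.mp hPA
  rw [Finset.mem_powerset] at hPz
  have hTne : (P.sup id).Nonempty := by
    obtain ⟨s, hs⟩ := hPne
    have hcard := (hface s (hPz hs)).2
    obtain ⟨x, hx⟩ : s.Nonempty := Finset.card_pos.mp (by omega)
    exact ⟨x, Finset.le_sup (f := id) hs hx⟩
  obtain rfl | hPss := hPz.eq_or_ssubset
  · -- The cycle lives on at most `N` vertices, where it cannot bound.
    have hna : ¬ AcyclicOn G (z.support.sup id) (k + 1) := fun hac => by
      obtain ⟨c, hcm, hcz⟩ := hac z ((Finsupp.mem_supported ℤ z).mpr fun s hs =>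
        ⟨Finset.le_sup (f := id) hs, hface s hs⟩) hz0
      exact hc ⟨c, cliqueChains_mono (Finset.subset_univ _) hcm, hcz⟩
    have hdense := mt (acyclicOn_of_degenerate (j := k)) hna
    push Not at hdense
    obtain ⟨T, hT, hTn, hdeg⟩ := hdense
    exact ⟨T, hTn, (Finset.card_le_card hT).trans hPN,
      Or.inl (SimpleGraph.HasEdgesIn.of_le_degree hdeg)⟩
  · obtain ⟨s, hs, t, ht, htP, v, hv, w, hw, hst⟩ := hconn P hPss hPne
    have hsT : s.erase v ⊆ P.sup id := (Finset.erase_subset v s).trans (Finset.le_sup (f := id) hs)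
    have hsup : (insert t P).sup id = insert w (P.sup id) := by
      rw [Finset.sup_insert, id, ← Finset.insert_erase hw, ← hst, Finset.sup_eq_union,
        Finset.insert_union, Finset.union_eq_right.mpr hsT]
    have hnot : ¬ ((insert w (P.sup id)).card ≤ N ∧ G.HasEdgesIn (insert w (P.sup id))
        (k * (insert w (P.sup id)).card - k * (k + 1))) := fun hin => by
      have := hmax (insert t P) (Finset.mem_filter.mpr ⟨Finset.mem_powerset.mpr
        (Finset.insert_subset ht hPz), Finset.insert_nonempty t P, by rwa [hsup]⟩)
      rw [Finset.card_insert_of_notMem htP] at this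
      omega
    by_cases hwT : w ∈ P.sup id
    · rw [Finset.insert_eq_of_mem hwT] at hnot
      exact absurd ⟨hPN, hPe⟩ hnot
    rw [Finset.card_insert_of_notMem hwT] at hnot
    have hedges : G.HasEdgesIn (insert w (P.sup id)) (k * ((P.sup id).card + 1) - k * (k + 1)) := by
      have hadj : ∀ u ∈ s.erase v, G.Adj w u := fun u hu => by
        obtain ⟨huw, hu⟩ := Finset.mem_erase.mp (hst ▸ hu)
        exact (hface t ht).1 (Finset.mem_coe.mpr hw) (Finset.mem_coe.mpr hu) huw.symm
      refine (hPe.insert_vertex hwT hsT hadj).mono ?_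
      rw [Finset.card_erase_of_mem hv, (hface s (hPz hs)).2, Nat.add_sub_cancel, mul_add_one k]
      omega
    have hcard : (P.sup id).card = N :=
      le_antisymm hPN (not_lt.mp fun hlt => hnot ⟨hlt, hedges⟩)
    exact ⟨P.sup id, hTne, hPN, Or.inr ⟨hcard, hcard ▸ hPe⟩⟩

end SimplicialHomology

/-! ### First-moment bounds in the binomial random graph -/

namespace SimpleGraph

open MeasureTheory ProbabilityTheory unitInterval
open scoped ENNReal

theorem binomialRandom_subset_edgeSet_le {V : Type*} [Countable V] (p : I) (F : Finset (Sym2 V)) :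
    binomialRandom V p {G | (F : Set (Sym2 V)) ⊆ G.edgeSet} ≤ (toNNReal p : ℝ≥0∞) ^ F.card := by
  rw [binomialRandom_apply]
  calc _ ≤ Measure.infinitePi
        (fun e : Sym2 V => toNNReal p • Measure.dirac (¬ e.IsDiag) +
          toNNReal (σ p) • Measure.dirac False)
        ((F : Set (Sym2 V)).pi fun _ => {True}) := by
        refine measure_mono ?_
        rintro _ ⟨G, hG, rfl⟩ e he
        exact eq_true (hG he)
    _ = ∏ e ∈ F, (toNNReal p • Measure.dirac (¬ e.IsDiag) +
          toNNReal (σ p) • Measure.dirac False) {True} :=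
        Measure.infinitePi_pi _ fun _ _ => MeasurableSet.of_discrete
    _ ≤ ∏ _e ∈ F, (toNNReal p : ℝ≥0∞) := by
        refine Finset.prod_le_prod' fun e _ => ?_
        rw [Measure.add_apply, Measure.smul_apply, Measure.smul_apply,
          Measure.dirac_apply' _ MeasurableSet.of_discrete,
          Measure.dirac_apply' _ MeasurableSet.of_discrete, Set.indicator_of_notMem (a := False) (by simp),
          smul_zero, add_zero, ENNReal.smul_def, smul_eq_mul]
        exact mul_le_of_le_one_right' (Set.indicator_le_self' (by simp) _)
    _ = _ := by rw [Finset.prod_const]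

/-- First-moment bound for subgraphs with `t` vertices and `m` edges. The factor
`2 ^ (t + 1).choose 2` bounds the number of choices of the edges inside a given vertex set. -/
theorem binomialRandom_hasEdgesIn_le (n t m : ℕ) (p : I) :
    binomialRandom (Fin n) p {G | ∃ T : Finset (Fin n), T.card = t ∧ G.HasEdgesIn T m} ≤
      (n : ℝ≥0∞) ^ t * (2 ^ (t + 1).choose 2 * (toNNReal p : ℝ≥0∞) ^ m) := by
  have hsub : {G : SimpleGraph (Fin n) | ∃ T : Finset (Fin n), T.card = t ∧ G.HasEdgesIn T m} ⊆
      ⋃ T ∈ Finset.powersetCard t (Finset.univ : Finset (Fin n)),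
        ⋃ F ∈ Finset.powersetCard m T.sym2, {G | (F : Set (Sym2 (Fin n))) ⊆ G.edgeSet} := by
    rintro G ⟨T, hT, F, hFG, hFT, hF⟩
    simp only [Set.mem_iUnion, Finset.mem_powersetCard]
    exact ⟨T, ⟨T.subset_univ, hT⟩, F,
      ⟨fun e he => Finset.mem_sym2_iff.mpr (hFT e he), hF⟩, hFG⟩
  have hedges : ∀ T ∈ Finset.powersetCard t (Finset.univ : Finset (Fin n)),
      binomialRandom (Fin n) p (⋃ F ∈ Finset.powersetCard m T.sym2,
        {G | (F : Set (Sym2 (Fin n))) ⊆ G.edgeSet}) ≤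
      2 ^ (t + 1).choose 2 * (toNNReal p : ℝ≥0∞) ^ m := by
    intro T hT
    refine (measure_biUnion_finset_le _ _).trans ((Finset.sum_le_card_nsmul _ _
      ((toNNReal p : ℝ≥0∞) ^ m) fun F hF => ?_).trans ?_)
    · exact (Finset.mem_powersetCard.mp hF).2 ▸ binomialRandom_subset_edgeSet_le p F
    · rw [nsmul_eq_mul, Finset.card_powersetCard, Finset.card_sym2,
        (Finset.mem_powersetCard.mp hT).2]
      gcongr
      exact_mod_cast Nat.choose_le_two_pow _ _
  refine (measure_mono hsub).trans ((measure_biUnion_finset_le _ _).trans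
    ((Finset.sum_le_card_nsmul _ _ _ hedges).trans ?_))
  rw [nsmul_eq_mul, Finset.card_powersetCard, Finset.card_univ, Fintype.card_fin]
  gcongr
  exact_mod_cast Nat.choose_le_pow n t

open Filter Topology in
theorem tendsto_binomialRandom_hasEdgesIn {α : ℝ} {p : ℕ → I}
    (hp : ∀ n : ℕ, 1 ≤ n → (p n : ℝ) = (n : ℝ) ^ α) {t m : ℕ} (h : (t : ℝ) + α * m < 0) :
    Tendsto (fun n : ℕ => binomialRandom (Fin n) (p n)
      {G | ∃ T : Finset (Fin n), T.card = t ∧ G.HasEdgesIn T m}) atTop (𝓝 0) := by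
  have hlim : Tendsto (fun n : ℕ => ENNReal.ofReal
      (2 ^ (t + 1).choose 2 * (n : ℝ) ^ ((t : ℝ) + α * m))) atTop (𝓝 0) := by
    rw [← ENNReal.ofReal_zero]
    refine ENNReal.tendsto_ofReal ?_
    have h1 := (tendsto_rpow_neg_atTop (neg_pos.mpr h)).comp tendsto_natCast_atTop_atTop
    rw [neg_neg] at h1
    simpa using h1.const_mul (2 ^ (t + 1).choose 2 : ℝ)
  refine tendsto_of_tendsto_of_tendsto_of_le_of_le' tendsto_const_nhds hlim
    (Eventually.of_forall fun _ => zero_le) ?_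
  filter_upwards [eventually_ge_atTop 1] with n hn
  refine (binomialRandom_hasEdgesIn_le n t m (p n)).trans (le_of_eq ?_)
  have hn0 : (0 : ℝ) < n := by exact_mod_cast hn
  have hpn : (toNNReal (p n) : ℝ≥0∞) = ENNReal.ofReal ((n : ℝ) ^ α) := by
    rw [← hp n hn, ← coe_toNNReal, ENNReal.ofReal_coe_nnreal]
  rw [hpn, Real.rpow_add hn0, Real.rpow_mul hn0.le, Real.rpow_natCast, Real.rpow_natCast,
    ENNReal.ofReal_mul (by positivity), ENNReal.ofReal_mul (by positivity),
    ENNReal.ofReal_pow hn0.le, ENNReal.ofReal_pow (Real.rpow_nonneg hn0.le α),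
    ENNReal.ofReal_pow (by norm_num), ENNReal.ofReal_natCast, ENNReal.ofReal_ofNat]
  ring

end SimpleGraph

/-! ### Vanishing of homology -/

theorem theorem3p6 (k : ℕ) (hk : 0 < k) (α : ℝ) (hα : α < -1 / (k : ℝ))
    (p : ℕ → unitInterval) (hp : ∀ n : ℕ, 1 ≤ n → (p n : ℝ) = (n : ℝ) ^ α) :
    Filter.Tendsto
      (fun n : ℕ => SimpleGraph.binomialRandom (Fin n) (p n)
        {G : SimpleGraph (Fin n) |
          Subsingleton (SimplicialHomology.ReducedHomology G.cliqueComplex k)})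
      Filter.atTop (nhds 1) := by
  have hk0 : (0 : ℝ) < k := by exact_mod_cast hk
  have hneg : 1 + α * k < 0 := by
    rw [lt_div_iff₀ hk0] at hα
    linarith
  -- `N` is so large that the loss of `k * (k + 1)` edges does not matter:
  -- `N + α * (k * N - k * (k + 1))` is negative.
  obtain ⟨N₀, hN₀⟩ := exists_nat_gt (α * (k * (k + 1)) / (1 + α * k))
  obtain ⟨N, hN₀N, hkN⟩ : ∃ N, N₀ ≤ N ∧ k + 1 ≤ N := ⟨max N₀ (k + 1), by simp, by simp⟩
  have hN : (N : ℝ) * (1 + α * k) < α * (k * (k + 1)) :=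
    (div_lt_iff_of_neg hneg).mp (hN₀.trans_le (by exact_mod_cast hN₀N))
  let E : ℕ → ℕ → (n : ℕ) → Set (SimpleGraph (Fin n)) := fun t m n =>
    {G | ∃ T : Finset (Fin n), T.card = t ∧ G.HasEdgesIn T m}
  have hbad : Filter.Tendsto (fun n => ∑ t ∈ Finset.Icc 1 N,
      SimpleGraph.binomialRandom (Fin n) (p n) (E t (k * t) n) +
      SimpleGraph.binomialRandom (Fin n) (p n) (E N (k * N - k * (k + 1)) n))
      Filter.atTop (nhds 0) := by
    have hsum := tendsto_finsetSum (Finset.Icc 1 N) fun t ht =>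
      SimpleGraph.tendsto_binomialRandom_hasEdgesIn hp (t := t) (m := k * t) (by
        have ht1 : (1 : ℝ) ≤ t := by exact_mod_cast (Finset.mem_Icc.mp ht).1
        push_cast
        nlinarith)
    have hlast := SimpleGraph.tendsto_binomialRandom_hasEdgesIn hp (t := N)
      (m := k * N - k * (k + 1)) (by
        rw [Nat.cast_sub (Nat.mul_le_mul_left k hkN)]
        push_cast
        linarith)
    simpa using hsum.add hlast
  have hlow := ENNReal.Tendsto.sub (tendsto_const_nhds (x := (1 : ENNReal))) hbad
    (Or.inl ENNReal.one_ne_top)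
  rw [tsub_zero] at hlow
  refine tendsto_of_tendsto_of_tendsto_of_le_of_le hlow tendsto_const_nhds (fun n => ?_)
    (fun n => MeasureTheory.prob_le_one)
  -- Measurability of the homological event is avoided by covering the whole space.
  rw [tsub_le_iff_right, ← MeasureTheory.measure_univ
    (μ := SimpleGraph.binomialRandom (Fin n) (p n))]
  have hcover : (Set.univ : Set (SimpleGraph (Fin n))) ⊆
      {G | Subsingleton (SimplicialHomology.ReducedHomology G.cliqueComplex k)} ∪
        ((⋃ t ∈ Finset.Icc 1 N, E t (k * t) n) ∪ E N (k * N - k * (k + 1)) n) := by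
    intro G _
    by_cases hG : SimplicialHomology.AcyclicOn G Finset.univ (k + 1)
    · exact Or.inl (SimplicialHomology.subsingleton_reducedHomology hG)
    obtain ⟨T, hTne, hTN, hT | ⟨hTN', hT⟩⟩ := SimplicialHomology.exists_dense_subset hkN hG
    · exact Or.inr (Or.inl (Set.mem_biUnion (x := T.card)
        (Finset.mem_Icc.mpr ⟨hTne.card_pos, hTN⟩) ⟨T, rfl, hT⟩))
    · exact Or.inr (Or.inr ⟨T, hTN', hT⟩)
  refine (MeasureTheory.measure_mono hcover).trans ((MeasureTheory.measure_union_le _ _).trans ?_)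
  gcongr
  refine (MeasureTheory.measure_union_le _ _).trans ?_
  gcongr
  exact MeasureTheory.measure_biUnion_finset_le _ _
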